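/- Let $1\le k\le n$ be integers. For $x\in\{0,1\}^n$ let $\chi_x:\{0,1\}^n\to\{0,1\}$ be the parity function $\chi_x(y)=\sum_{i=1}^n x_iy_i \bmod 2$, and let $\mathsf{PAR}^n_k$ be the set of all $k$-parities, that is, of all $\chi_x$ with $x$ of Hamming weight $k$. For $\varepsilon>0$, a function $f:\{0,1\}^n\to\{0,1\}$ is $\varepsilon$-far from $\mathsf{PAR}^n_k$ if it differs from every $g\in\mathsf{PAR}^n_k$ on at least $\varepsilon 2^n$ inputs. A non-adaptive tester with $q$ queries is a probability distribution over deterministic procedures each of which queries $f$ at $q$ points of $\{0,1\}^n$ fixed in advance and then accepts or rejects as a function of the $q$ answers only. Theorem. For every constant $\varepsilon>0$ (for example $\varepsilon=1/10$) there is a constant $C>0$, depending only on $\varepsilon$, such that for all integers $1\le k\le n$ there is a non-adaptive tester which makes at most $C\cdot\max\{1,k\log k\}$ queries (so $O(k\log k)$ queries for $k\ge 2$, independently of $n$, and $O(1)$ queries for $k=1$) and which, for every $f:\{0,1\}^n\to\{0,1\}$, accepts with probability at least $2/3$ if $f\in\mathsf{PAR}^n_k$, and rejects with probability at least $2/3$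 if $f$ is $\varepsilon$-far from $\mathsf{PAR}^n_k$. -/

import Mathlib

namespace ParityTesting

/-- The Boolean cube `{0,1}ⁿ`, with bits in `ZMod 2`. -/
abbrev Cube (n : ℕ) : Type := Fin n → ZMod 2

/-- Boolean functions `f : {0,1}ⁿ → {0,1}`. -/
abbrev BoolFun (n : ℕ) : Type := Cube n → ZMod 2

/-- The parity function `χ_x(y) = ⟨x, y⟩ = ∑ i, x i * y i` modulo 2. -/
def parity {n : ℕ} (x : Cube n) : BoolFun n := fun y => dotProduct x y

/-- The set of `k`-parities on `n` bits: the functions `χ_x` with `x` of Hamming weight `k`. -/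
def PAR (n k : ℕ) : Set (BoolFun n) := {f | ∃ x : Cube n, hammingNorm x = k ∧ f = parity x}

/-- The fraction of the `2ⁿ` inputs on which `f` and `g` differ. -/
noncomputable def relDist {n : ℕ} (f g : BoolFun n) : ℝ := (hammingDist f g : ℝ) / 2 ^ n

/-- `f` is `ε`-far from `G`: it differs from every member of `G` on at least
an `ε` fraction of the domain. -/
def IsFar {n : ℕ} (ε : ℝ) (f : BoolFun n) (G : Set (BoolFun n)) : Prop :=
  ∀ g ∈ G, ε ≤ relDist f g

/-- A deterministic non-adaptive tester with `q` queries: a list of `q` query points that is fixed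
before any answer is seen, and a decision that depends only on the `q` answers
(`true` means accept). -/
structure DetTester (n q : ℕ) where
  query : Fin q → Cube n
  decision : (Fin q → ZMod 2) → Bool

/-- The output of a deterministic tester that has oracle access to `f`. -/
def DetTester.run {n q : ℕ} (t : DetTester n q) (f : BoolFun n) : Bool :=
  t.decision fun i => f (t.query i)

/-- A randomized non-adaptive tester with `q` queries: a probability distribution over the
deterministic ones. -/
abbrev Tester (n q : ℕ) : Type := PMF (DetTester n q)

/-- The distribution of the output of a randomized tester that has oracle access to `f`. -/
noncomputable def Tester.output {n q : ℕ} (T : Tester n q) (f : BoolFun n) : PMF Bool :=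
  PMF.map (fun t => t.run f) T

/-- `T` decides, with probability at least `2/3` on each admissible input, whether the function is
in `G` (accept) or `ε`-far from `G` (reject). -/
def Tester.Tests {n q : ℕ} (T : Tester n q) (ε : ℝ) (G : Set (BoolFun n)) : Prop :=
  (∀ f : BoolFun n, f ∈ G → 2 / 3 ≤ Tester.output T f true) ∧
  (∀ f : BoolFun n, IsFar ε f G → 2 / 3 ≤ Tester.output T f false)

end ParityTesting

/-!
The tester rests on three ideas.

*Linearity.* A constant number of runs of the Blum–Luby–Rubinfeld test most likely rejects every
function that is not `δ`-close to some parity `χ_a` (`exists_parity_close_of_linearity_test`, by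
Fourier analysis on the cube). If `f` is far from `PAR n k` but `δ`-close to `χ_a`, then the weight
of `a` is not `k`.

*Hashing.* A random function `h` from the `n` coordinates to `m = 100 k ^ 2` buckets turns `a` into
a vector `push h a` on the buckets, and `χ_a (y ∘ h) = χ_{push h a} y`. Whether the weight equals
`k` is preserved with probability at least `9/10`. Weight cannot grow. If `a` has weight `k`, there is
most likely no collision. If `a` has weight greater than `k`, take a set `A` of `k + 1` coordinates
in its support, and fix the buckets of all the others; then either these alone leave too many odd
buckets for `A` to cancel, or `A` most likely falls injectively into even buckets
(`prob_hammingNorm_push_lt_card_le`). This makes the number of queries independent of `n`.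

*Decoding.* There are at most `m ^ k` vectors of weight `k` on the buckets, so the values at
`O(k log m) = O(k log k)` random points `y` separate `χ_{push h a}` from all their parities by a
union bound (`prob_exists_agreement_le`). The points `y ∘ h` are not uniform in the cube, so the
values of `χ_a` there are read off as `f (y ∘ h + r) + f r` with a random `r`; few of these values
are wrong (`prob_many_errors_le`). The tester accepts if some parity of weight `k` on the buckets
agrees with at least seven eighths of the values.
-/

namespace ParityTesting

open Finset Function
open scoped BigOperators

/-! ### Probabilities over finite uniform spaces -/

section Prob

variable {Ω α β ι : Type*} [Fintype Ω] [Fintype α] [Fintype β]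

open Classical in
/-- The probability of the event `P` under the uniform distribution on the finite type `Ω`. -/
noncomputable def prob (P : Ω → Prop) : ℝ := 𝔼 ω, if P ω then (1 : ℝ) else 0

theorem prob_nonneg (P : Ω → Prop) : 0 ≤ prob P :=
  expect_nonneg fun ω _ => by split_ifs <;> norm_num

theorem prob_mono {P Q : Ω → Prop} (h : ∀ ω, P ω → Q ω) : prob P ≤ prob Q := by
  refine expect_le_expect fun ω _ => ?_
  by_cases hP : P ω
  · simp [hP, h ω hP]
  · rw [if_neg hP]; split_ifs <;> norm_num

theorem prob_or_le (P Q : Ω → Prop) : prob (fun ω => P ω ∨ Q ω) ≤ prob P + prob Q := by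
  unfold prob
  rw [← expect_add_distrib]
  refine expect_le_expect fun ω _ => ?_
  by_cases hP : P ω <;> by_cases hQ : Q ω <;> simp [hP, hQ]

theorem prob_exists_le (s : Finset ι) (P : ι → Ω → Prop) :
    prob (fun ω => ∃ i ∈ s, P i ω) ≤ ∑ i ∈ s, prob (P i) := by
  classical
  induction s using Finset.induction_on with
  | empty => simp [prob]
  | insert a s ha ih =>
    rw [sum_insert ha]
    calc prob (fun ω => ∃ i ∈ insert a s, P i ω)
        ≤ prob (fun ω => P a ω ∨ ∃ i ∈ s, P i ω) := prob_mono fun ω h => by simpa using h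
      _ ≤ _ := (prob_or_le _ _).trans (by linarith)

theorem prob_not [Nonempty Ω] (P : Ω → Prop) : prob (fun ω => ¬ P ω) = 1 - prob P := by
  unfold prob
  rw [eq_sub_iff_add_eq, ← expect_add_distrib, ← Fintype.expect_one (ι := Ω) (M := ℝ)]
  refine expect_congr rfl fun ω _ => ?_
  by_cases hP : P ω <;> simp [hP]

theorem prob_eq_card_div (P : Ω → Prop) [DecidablePred P] :
    prob P = (#{ω | P ω} : ℝ) / Fintype.card Ω := by
  unfold prob
  rw [Fintype.expect_eq_sum_div_card, card_filter]
  push_cast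
  congr!

theorem prob_equiv (e : α ≃ β) (P : β → Prop) : prob (fun a => P (e a)) = prob P :=
  Fintype.expect_equiv e _ _ fun _ => rfl

theorem prob_prod_le_of_fst [Nonempty α] {P : α × β → Prop} {c : ℝ}
    (h : ∀ a, prob (fun b => P (a, b)) ≤ c) : prob P ≤ c := by
  unfold prob
  rw [← univ_product_univ, expect_product]
  exact expect_le univ_nonempty fun a _ => h a

theorem prob_prod_le_of_snd [Nonempty β] {P : α × β → Prop} {c : ℝ}
    (h : ∀ b, prob (fun a => P (a, b)) ≤ c) : prob P ≤ c := by
  rw [← prob_equiv (Equiv.prodComm β α)]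
  exact prob_prod_le_of_fst h

/-- Resampling one coordinate of a uniformly random function does not change its law. -/
theorem expect_update [Fintype ι] [DecidableEq ι] [Nonempty α] (i : ι) (F : (ι → α) → ℝ) :
    𝔼 y, 𝔼 c, F (update y i c) = 𝔼 y, F y := by
  have hinv : Involutive fun p : (ι → α) × α => (update p.1 i p.2, p.1 i) := by
    rintro ⟨y, c⟩
    simp
  calc 𝔼 y, 𝔼 c, F (update y i c)
      = 𝔼 p : (ι → α) × α, F (update p.1 i p.2) := by
        rw [← univ_product_univ, expect_product]
    _ = 𝔼 p : (ι → α) × α, F p.1 := Fintype.expect_equiv hinv.toPerm _ _ fun _ => rfl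
    _ = 𝔼 y, F y := by
        rw [← univ_product_univ, expect_product]
        simp

theorem prob_le_of_update [Fintype ι] [DecidableEq ι] [Nonempty α] (i : ι)
    {P : (ι → α) → Prop} {c : ℝ} (h : ∀ y, prob (fun a => P (update y i a)) ≤ c) :
    prob P ≤ c := by
  unfold prob
  rw [← expect_update i]
  exact expect_le univ_nonempty fun y _ => h y

theorem prob_mul_le_expect {X : Ω → ℝ} (hX : ∀ ω, 0 ≤ X ω) (c : ℝ) :
    prob (fun ω => c ≤ X ω) * c ≤ 𝔼 ω, X ω := by
  unfold prob
  rw [expect_mul]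
  refine expect_le_expect fun ω _ => ?_
  split_ifs with h
  · simpa using h
  · simpa using hX ω

theorem expect_prod_apply (N : ℕ) (g : α → ℝ) :
    𝔼 y : Fin N → α, ∏ i, g (y i) = (𝔼 a, g a) ^ N := by
  rw [expect_pow, Fintype.piFinset_univ]

theorem prob_forall_apply (N : ℕ) (P : α → Prop) :
    prob (fun y : Fin N → α => ∀ i, P (y i)) = prob P ^ N := by
  unfold prob
  rw [← expect_prod_apply]
  refine expect_congr rfl fun y _ => ?_
  classical
  rw [prod_boole]
  congr 1
  simp

theorem two_thirds_le_map_uniform [Nonempty Ω] {γ : Type*} {g : Ω → γ} {b : γ}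
    (h : prob (fun ω => g ω ≠ b) ≤ 1 / 3) :
    2 / 3 ≤ PMF.map g (PMF.uniformOfFintype Ω) b := by
  classical
  have h1 : 2 / 3 ≤ prob (fun ω => g ω = b) := by
    have := prob_not (fun ω => g ω = b)
    linarith
  rw [prob_eq_card_div, div_le_div_iff₀ (by norm_num) (by exact_mod_cast Fintype.card_pos)] at h1
  rw [← PMF.toOuterMeasure_apply_singleton, PMF.toOuterMeasure_map_apply,
    PMF.toOuterMeasure_uniformOfFintype_apply]
  have h2 : Fintype.card (g ⁻¹' {b}) = #{ω | g ω = b} := by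
    rw [← Fintype.card_subtype]
    rfl
  rw [h2, ENNReal.div_le_iff (by norm_num) (by norm_num), mul_comm, ← mul_div_assoc,
    ENNReal.le_div_iff_mul_le (by simp) (by simp)]
  rw [mul_comm (3 : ENNReal)]
  exact_mod_cast h1

end Prob

/-! ### Fourier analysis on the cube and the linearity test -/

/-- The real character of `ZMod 2`: the sign `(-1) ^ b`. -/
noncomputable def sgn (b : ZMod 2) : ℝ := if b = 0 then 1 else -1

theorem sgn_add (a b : ZMod 2) : sgn (a + b) = sgn a * sgn b := by
  have h : ∀ a b : ZMod 2, (a + b = 0) ↔ (a = 0 ↔ b = 0) := by decide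
  unfold sgn
  by_cases ha : a = 0 <;> by_cases hb : b = 0 <;> simp [h, ha, hb]

theorem sgn_mul_self (a : ZMod 2) : sgn a * sgn a = 1 := by
  unfold sgn; split_ifs <;> norm_num

theorem sgn_mul_eq (a b : ZMod 2) : sgn a * sgn b = 1 - 2 * (if a ≠ b then 1 else 0) := by
  have h : ∀ a b : ZMod 2, (a + b = 0) ↔ a = b := by decide
  rw [← sgn_add]
  unfold sgn
  by_cases hab : a = b
  · simp [h, hab]
  · norm_num [h, hab]

theorem sum_sgn_dotProduct {n : ℕ} (u : Cube n) :
    ∑ a : Cube n, sgn (dotProduct a u) = if u = 0 then (2 : ℝ) ^ n else 0 := by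
  split_ifs with hu
  · simp [hu, sgn]
  · obtain ⟨i, hi⟩ := Function.ne_iff.mp hu
    have hi1 : u i = 1 := by
      have : ∀ b : ZMod 2, b ≠ 0 → b = 1 := by decide
      exact this _ hi
    have h := Equiv.sum_comp (Equiv.addRight (Pi.single i (1 : ZMod 2)))
      (fun a : Cube n => sgn (dotProduct a u))
    have h1 : sgn 1 = -1 := by simp [sgn]
    simp only [Equiv.coe_addRight, add_dotProduct, sgn_add, single_dotProduct, hi1, h1,
      mul_neg, mul_one, sum_neg_distrib] at h
    linarith

/-- The unnormalized Fourier coefficient at `a` of the sign function `(-1) ^ f`. -/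
noncomputable def fourier {n : ℕ} (f : BoolFun n) (a : Cube n) : ℝ :=
  ∑ y, sgn (f y) * sgn (dotProduct a y)

/-- Parseval's identity for the sign function of `f`. -/
theorem sum_fourier_sq {n : ℕ} (f : BoolFun n) :
    ∑ a, fourier f a ^ 2 = (2 : ℝ) ^ n * 2 ^ n := by
  have h0 : ∀ x y : Cube n, x + y = 0 ↔ y = x := fun x y => by
    rw [add_eq_zero_iff_eq_neg, ZModModule.neg_eq_self, eq_comm]
  calc ∑ a, fourier f a ^ 2
      = ∑ a, ∑ x, ∑ y, sgn (f x) * sgn (f y) * sgn (dotProduct a (x + y)) := by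
        refine sum_congr rfl fun a _ => ?_
        rw [sq, fourier, sum_mul_sum]
        refine sum_congr rfl fun x _ => sum_congr rfl fun y _ => ?_
        rw [dotProduct_add, sgn_add]
        ring
    _ = ∑ x, ∑ y, sgn (f x) * sgn (f y) * ∑ a, sgn (dotProduct a (x + y)) := by
        rw [sum_comm]
        refine sum_congr rfl fun x _ => ?_
        rw [sum_comm]
        simp only [mul_sum]
    _ = 2 ^ n * 2 ^ n := by
        simp_rw [sum_sgn_dotProduct, h0]
        simp [sgn_mul_self]

/-- The sum of the cubes of the Fourier coefficients measures how often `f` passes the linearity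
test. -/
theorem sum_fourier_cube {n : ℕ} (f : BoolFun n) :
    ∑ a, fourier f a ^ 3 = (2 : ℝ) ^ n * ∑ x, ∑ y, sgn (f x) * sgn (f y) * sgn (f (x + y)) := by
  have h0 : ∀ x y z : Cube n, x + y + z = 0 ↔ z = x + y := fun x y z => by
    rw [add_eq_zero_iff_eq_neg, ZModModule.neg_eq_self, eq_comm]
  calc ∑ a, fourier f a ^ 3
      = ∑ a, ∑ x, ∑ y, ∑ z, sgn (f x) * sgn (f y) * sgn (f z) *
          sgn (dotProduct a (x + y + z)) := by
        refine sum_congr rfl fun a _ => ?_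
        rw [pow_succ, sq, fourier, sum_mul_sum, sum_mul]
        refine sum_congr rfl fun x _ => ?_
        rw [sum_mul_sum]
        refine sum_congr rfl fun y _ => sum_congr rfl fun z _ => ?_
        rw [dotProduct_add, dotProduct_add, sgn_add, sgn_add]
        ring
    _ = ∑ x, ∑ y, ∑ z, sgn (f x) * sgn (f y) * sgn (f z) *
          ∑ a, sgn (dotProduct a (x + y + z)) := by
        rw [sum_comm]
        refine sum_congr rfl fun x _ => ?_
        rw [sum_comm]
        refine sum_congr rfl fun y _ => ?_
        rw [sum_comm]
        simp only [mul_sum]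
    _ = _ := by
        simp only [sum_sgn_dotProduct, h0, mul_ite, mul_zero, sum_ite_eq', mem_univ, if_true,
          ← sum_mul]
        rw [mul_comm]

theorem fourier_eq {n : ℕ} (f : BoolFun n) (a : Cube n) :
    fourier f a = 2 ^ n - 2 * hammingDist f (parity a) := by
  unfold fourier hammingDist
  simp only [sgn_mul_eq, sum_sub_distrib, ← mul_sum, sum_boole, sum_const, card_univ]
  simp [parity]
  congr!

theorem card_cube (n : ℕ) : (Fintype.card (Cube n) : ℝ) = 2 ^ n := by simp

/-- Soundness of the linearity test of Blum, Luby and Rubinfeld: a function that fails it with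
probability at most `δ` is `δ`-close to a parity. The largest Fourier coefficient is at least the
ratio of the sum of the cubes to the sum of the squares. -/
theorem exists_parity_close_of_linearity_test {n : ℕ} (f : BoolFun n) {δ : ℝ}
    (h : prob (fun p : Cube n × Cube n => f p.1 + f p.2 ≠ f (p.1 + p.2)) ≤ δ) :
    ∃ a : Cube n, relDist f (parity a) ≤ δ := by
  classical
  have hN : (0 : ℝ) < 2 ^ n := by positivity
  obtain ⟨a, ha⟩ := Finite.exists_max (fourier f)
  refine ⟨a, ?_⟩
  have hsum : ∑ x, ∑ y, sgn (f x) * sgn (f y) * sgn (f (x + y)) =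
      2 ^ n * 2 ^ n *
        (1 - 2 * prob (fun p : Cube n × Cube n => f p.1 + f p.2 ≠ f (p.1 + p.2))) := by
    have hcard : (2 : ℝ) ^ n * 2 ^ n = Fintype.card (Cube n × Cube n) := by
      rw [Fintype.card_prod, Nat.cast_mul, card_cube]
    rw [hcard, mul_sub, mul_left_comm, prob, Fintype.card_mul_expect, ← Fintype.sum_prod_type',
      mul_sum]
    simp_rw [← sgn_add (f _) (f _), sgn_mul_eq, sum_sub_distrib]
    congr 1
    · simp
    · refine sum_congr rfl fun p _ => ?_
      congr!
  have hcube : ∑ b, fourier f b ^ 3 ≤ fourier f a * (2 ^ n * 2 ^ n) := by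
    rw [← sum_fourier_sq f, mul_sum]
    refine sum_le_sum fun b _ => ?_
    rw [pow_succ, mul_comm]
    exact mul_le_mul_of_nonneg_right (ha b) (sq_nonneg _)
  rw [sum_fourier_cube, hsum, fourier_eq] at hcube
  rw [relDist, div_le_iff₀ hN]
  have h2 : (2 : ℝ) ^ n * (1 - 2 * δ) ≤ 2 ^ n - 2 * hammingDist f (parity a) := by
    refine le_of_mul_le_mul_right (le_trans ?_ hcube) (mul_pos hN hN)
    rw [← sub_nonneg]
    have : 0 ≤ 2 * (2 ^ n * 2 ^ n * 2 ^ n) *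
      (δ - prob (fun p : Cube n × Cube n => f p.1 + f p.2 ≠ f (p.1 + p.2))) :=
        mul_nonneg (by positivity) (by linarith)
    linarith
  linarith

theorem prob_ne_parity {n : ℕ} (f : BoolFun n) (a : Cube n) :
    prob (fun y => f y ≠ parity a y) = relDist f (parity a) := by
  classical
  rw [prob_eq_card_div, card_cube, relDist, hammingDist]

/-! ### Hashing the coordinates into buckets -/

/-- The image of a vector under a hash function `h`: the bit of the bucket `j` is the sum modulo 2
of the bits that `h` sends to `j`. -/
def push {n m : ℕ} (h : Fin n → Fin m) (a : Cube n) : Cube m :=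
  fun j => ∑ i, if h i = j then a i else 0

/-- The vector `a` with the coordinates in `A` set to zero. -/
def eraseOn {n : ℕ} (A : Finset (Fin n)) (a : Cube n) : Cube n :=
  fun i => if i ∈ A then 0 else a i

section Push

variable {n m : ℕ} (h : Fin n → Fin m) (a : Cube n)

theorem dotProduct_push (y : Cube m) : dotProduct (push h a) y = dotProduct a (y ∘ h) := by
  simp only [dotProduct, push, sum_mul, ite_mul, zero_mul]
  rw [sum_comm]
  simp

theorem push_sub (b : Cube n) : push h (a - b) = push h a - push h b := by
  funext j
  simp only [push, Pi.sub_apply, ← sum_sub_distrib]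
  refine sum_congr rfl fun i _ => ?_
  split_ifs <;> simp

theorem hammingNorm_push_le : hammingNorm (push h a) ≤ hammingNorm a := by
  classical
  refine (card_le_card ?_).trans (card_image_le (s := {i | a i ≠ 0}) (f := h))
  intro j hj
  simp only [mem_filter, mem_univ, true_and] at hj
  obtain ⟨i, -, hi⟩ := exists_ne_zero_of_sum_ne_zero hj
  have hij : h i = j := by
    by_contra hne
    exact hi (if_neg hne)
  exact mem_image.mpr ⟨i, by simpa [hij] using hi, hij⟩

theorem hammingNorm_push_eraseOn_le (A : Finset (Fin n)) :
    hammingNorm (push h (eraseOn A a)) ≤ hammingNorm (push h a) + #A := by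
  have h1 := hammingDist_triangle (push h (eraseOn A a)) (push h a) 0
  rw [hammingDist_zero_right, hammingDist_zero_right, hammingDist_eq_hammingNorm,
    neg_add_eq_sub, ← push_sub] at h1
  have h2 := hammingNorm_push_le h (a - eraseOn A a)
  have h3 : hammingNorm (a - eraseOn A a) ≤ #A := by
    refine card_le_card fun i hi => ?_
    by_contra hiA
    exact (mem_filter.mp hi).2 (by simp [eraseOn, hiA])
  omega

theorem push_update_eraseOn {A : Finset (Fin n)} {i : Fin n} (hi : i ∈ A) (c : Fin m) :
    push (update h i c) (eraseOn A a) = push h (eraseOn A a) := by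
  funext j
  refine sum_congr rfl fun l _ => ?_
  by_cases hl : l = i
  · subst hl
    simp [eraseOn, hi]
  · rw [update_of_ne hl]

theorem card_le_hammingNorm_push {A : Finset (Fin n)} (hA : ∀ i ∈ A, a i ≠ 0)
    (hinj : ∀ i ∈ A, ∀ l ∈ A, h l = h i → l = i)
    (hoff : ∀ i ∈ A, push h (eraseOn A a) (h i) = 0) : #A ≤ hammingNorm (push h a) := by
  classical
  refine card_le_card_of_injOn h (fun i hi => ?_) fun i hi l hl hil => hinj l hl i hi hil
  have hi' : i ∈ A := hi
  have hsplit : push h a (h i) = push h (eraseOn A a) (h i) + a i := by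
    have : (a i) = ∑ l, if l = i then a l else 0 := by simp
    rw [this]
    unfold push
    rw [← sum_add_distrib]
    refine sum_congr rfl fun l _ => ?_
    by_cases hli : l = i
    · subst hli
      simp [eraseOn, hi']
    · by_cases hlA : l ∈ A
      · have : h l ≠ h i := fun e => hli (hinj i hi' l hlA e)
        simp [this, hli]
      · simp [eraseOn, hlA, hli]
  simp only [coe_filter, mem_univ, true_and, Set.mem_ofPred_eq]
  rw [hsplit, hoff i hi', zero_add]
  exact hA i hi'

/-- Hashing rarely destroys weight. Fix the buckets of all the coordinates outside `A`, and let `v`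
be the vector that these produce. If the weight of `v` exceeds `2k + 1`, then the at most `k + 1`
coordinates in `A` cannot bring it down below `#A`; otherwise each of them is likely to fall into a
bucket of its own outside the support of `v`. -/
theorem prob_hammingNorm_push_lt_card_le [NeZero m] (k : ℕ) {A : Finset (Fin n)}
    (hA : ∀ i ∈ A, a i ≠ 0) (hk : #A ≤ k + 1) :
    prob (fun h : Fin n → Fin m => hammingNorm (push h a) < #A) ≤
      (k + 1) * (3 * k + 2) / m := by
  classical
  let bad : Fin n → (Fin n → Fin m) → Prop := fun i h =>
    (∃ l ∈ A, l ≠ i ∧ h l = h i) ∨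
      (hammingNorm (push h (eraseOn A a)) ≤ 2 * k + 1 ∧ push h (eraseOn A a) (h i) ≠ 0)
  have hbad : ∀ i ∈ A, prob (bad i) ≤ (3 * k + 2) / m := by
    intro i hi
    refine prob_le_of_update i fun h => ?_
    rw [prob_eq_card_div, Fintype.card_fin]
    gcongr
    let v := push h (eraseOn A a)
    have hsub : ({c | bad i (update h i c)} : Finset (Fin m)) ⊆
        A.image h ∪ if hammingNorm v ≤ 2 * k + 1 then ({j | v j ≠ 0} : Finset (Fin m)) else ∅ := by
      intro c hc
      simp only [mem_filter, mem_univ, true_and, bad, push_update_eraseOn h a hi,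
        update_self] at hc
      rcases hc with ⟨l, hl, hli, hlc⟩ | ⟨hv, hvc⟩
      · rw [update_of_ne hli] at hlc
        exact mem_union_left _ (mem_image.mpr ⟨l, hl, hlc⟩)
      · refine mem_union_right _ ?_
        rw [if_pos hv]
        simpa using hvc
    have hcard : #(if hammingNorm v ≤ 2 * k + 1 then ({j | v j ≠ 0} : Finset (Fin m)) else ∅)
        ≤ 2 * k + 1 := by
      split_ifs with hv
      · exact hv
      · simp
    have := (card_le_card hsub).trans (card_union_le _ _)
    have := (card_image_le (s := A) (f := h))
    have : #({c | bad i (update h i c)} : Finset (Fin m)) ≤ 3 * k + 2 := by omega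
    exact_mod_cast this
  have hmain : ∀ h : Fin n → Fin m, hammingNorm (push h a) < #A → ∃ i ∈ A, bad i h := by
    intro h hlt
    by_contra hne
    simp only [bad, not_exists, not_and, not_or, not_not] at hne
    have hv : hammingNorm (push h (eraseOn A a)) ≤ 2 * k + 1 := by
      have := hammingNorm_push_eraseOn_le h a A
      omega
    refine hlt.not_ge (card_le_hammingNorm_push h a hA (fun i hi l hl hil => ?_)
      fun i hi => (hne i hi).2 hv)
    by_contra hli
    exact (hne i hi).1 l hl hli hil
  calc prob (fun h : Fin n → Fin m => hammingNorm (push h a) < #A)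
      ≤ prob (fun h => ∃ i ∈ A, bad i h) := prob_mono hmain
    _ ≤ ∑ i ∈ A, prob (bad i) := prob_exists_le _ _
    _ ≤ #A • ((3 * k + 2) / m : ℝ) := sum_le_card_nsmul _ _ _ hbad
    _ ≤ (k + 1) * (3 * k + 2) / m := by
        rw [nsmul_eq_mul, mul_div_assoc]
        gcongr
        exact_mod_cast hk

theorem collision_bound_le {k : ℕ} (hk : 1 ≤ k) (hm : m = 100 * k ^ 2) :
    ((k : ℝ) + 1) * (3 * k + 2) / m ≤ 1 / 10 := by
  have hk' : (1 : ℝ) ≤ k := by exact_mod_cast hk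
  subst hm
  push_cast
  rw [div_le_div_iff₀ (by positivity) (by norm_num)]
  nlinarith

theorem prob_hammingNorm_push_ne_le {k : ℕ} (hk : 1 ≤ k) (hm : m = 100 * k ^ 2)
    (ha : hammingNorm a = k) :
    prob (fun h : Fin n → Fin m => hammingNorm (push h a) ≠ k) ≤ 1 / 10 := by
  have : NeZero m := ⟨by subst hm; positivity⟩
  have hA : #{i | a i ≠ 0} = k := ha
  refine le_trans (prob_mono fun h hne => ?_)
    ((prob_hammingNorm_push_lt_card_le a k (A := {i | a i ≠ 0}) (by simp) (by omega)).trans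
      (collision_bound_le hk hm))
  have := hammingNorm_push_le h a
  omega

theorem prob_hammingNorm_push_eq_le {k : ℕ} (hk : 1 ≤ k) (hm : m = 100 * k ^ 2)
    (ha : hammingNorm a ≠ k) :
    prob (fun h : Fin n → Fin m => hammingNorm (push h a) = k) ≤ 1 / 10 := by
  have : NeZero m := ⟨by subst hm; positivity⟩
  rcases lt_or_gt_of_ne ha with hlt | hgt
  · refine le_trans (prob_mono (Q := fun _ => False) fun h heq => ?_) (by simp [prob])
    have := hammingNorm_push_le h a
    omega
  · obtain ⟨A, hAsub, hA⟩ := exists_subset_card_eq (s := ({i | a i ≠ 0} : Finset (Fin n)))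
      (n := k + 1) hgt
    refine le_trans (prob_mono fun h heq => ?_)
      ((prob_hammingNorm_push_lt_card_le a k (A := A) (fun i hi => by simpa using hAsub hi)
        hA.le).trans (collision_bound_le hk hm))
    omega

end Push

/-! ### Random parity checks -/

section Code

theorem expect_sgn_dotProduct {m : ℕ} {u : Cube m} (hu : u ≠ 0) :
    𝔼 y : Cube m, sgn (dotProduct u y) = 0 := by
  simp_rw [dotProduct_comm u]
  rw [Fintype.expect_eq_sum_div_card, sum_sgn_dotProduct, if_neg hu, zero_div]

/-- Two different parities agree on three quarters of `4p` random points with probability at most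
`(2/3) ^ p`: the exponential Markov inequality, applied to `2` to the number of agreements, whose
expectation is `(3/2) ^ (4p)`. -/
theorem prob_agreement_le {m : ℕ} {a b : Cube m} (hab : a ≠ b) (p : ℕ) :
    prob (fun y : Fin (4 * p) → Cube m => 3 * p ≤ #{i | parity a (y i) = parity b (y i)}) ≤
      (2 / 3 : ℝ) ^ p := by
  classical
  let g : Cube m → ℝ := fun y => if parity a y = parity b y then 2 else 1
  have hg : 𝔼 y, g y = 3 / 2 := by
    have h1 : ∀ y, g y = 3 / 2 + 1 / 2 * sgn (dotProduct (a - b) y) := by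
      intro y
      have h2 : dotProduct (a - b) y = 0 ↔ parity a y = parity b y := by
        rw [sub_dotProduct, sub_eq_zero, parity, parity]
      simp only [g, sgn, h2]
      split_ifs <;> norm_num
    simp_rw [h1]
    rw [expect_add_distrib, ← mul_expect, expect_sgn_dotProduct (sub_ne_zero.mpr hab)]
    simp
  have hX : ∀ y : Fin (4 * p) → Cube m,
      ∏ i, g (y i) = (2 : ℝ) ^ #{i | parity a (y i) = parity b (y i)} := by
    intro y
    simp [g, prod_ite]
  have hmk := prob_mul_le_expect (X := fun y : Fin (4 * p) → Cube m => ∏ i, g (y i))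
    (fun y => by rw [hX]; positivity) ((2 : ℝ) ^ (3 * p))
  rw [expect_prod_apply, hg] at hmk
  have hle : prob (fun y : Fin (4 * p) → Cube m =>
      3 * p ≤ #{i | parity a (y i) = parity b (y i)}) ≤
      prob (fun y : Fin (4 * p) → Cube m => (2 : ℝ) ^ (3 * p) ≤ ∏ i, g (y i)) := by
    refine prob_mono fun y hy => ?_
    rw [hX]
    exact pow_le_pow_right₀ (by norm_num) hy
  refine hle.trans ?_
  rw [← le_div_iff₀ (by positivity)] at hmk
  refine hmk.trans ?_
  rw [pow_mul, pow_mul, ← div_pow]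
  exact pow_le_pow_left₀ (by norm_num) (by norm_num) _

theorem card_hammingNorm_eq_le (m k : ℕ) : #{z : Cube m | hammingNorm z = k} ≤ m ^ k := by
  classical
  have h : #{z : Cube m | hammingNorm z = k} ≤ #(powersetCard k (univ : Finset (Fin m))) := by
    refine card_le_card_of_injOn (fun z => ({i | z i ≠ 0} : Finset (Fin m))) ?_ ?_
    · intro z hz
      simp only [coe_filter, mem_univ, true_and, Set.mem_ofPred_eq] at hz
      simpa [mem_powersetCard, hammingNorm] using hz
    · intro z _ w _ hzw
      funext i
      have hi := congrArg (fun s : Finset (Fin m) => i ∈ s) hzw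
      simp only [mem_filter, mem_univ, true_and, eq_iff_iff] at hi
      have h2 : ∀ b c : ZMod 2, (b ≠ 0 ↔ c ≠ 0) → b = c := by decide
      exact h2 _ _ hi
  rw [card_powersetCard, card_univ, Fintype.card_fin] at h
  exact h.trans (Nat.choose_le_pow m k)

theorem prob_exists_agreement_le {m : ℕ} (a : Cube m) (k p : ℕ) :
    prob (fun y : Fin (4 * p) → Cube m => ∃ z : Cube m, hammingNorm z = k ∧ z ≠ a ∧
      3 * p ≤ #{i | parity z (y i) = parity a (y i)}) ≤ (m : ℝ) ^ k * (2 / 3) ^ p := by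
  classical
  let S : Finset (Cube m) := {z | hammingNorm z = k ∧ z ≠ a}
  have hS : #S ≤ m ^ k := (card_le_card fun z hz => by
    simp only [S, mem_filter, mem_univ, true_and] at hz ⊢
    exact hz.1).trans (card_hammingNorm_eq_le m k)
  calc _ ≤ prob (fun y : Fin (4 * p) → Cube m => ∃ z ∈ S,
        3 * p ≤ #{i | parity z (y i) = parity a (y i)}) := by
        refine prob_mono ?_
        rintro y ⟨z, hz, hza, h⟩
        exact ⟨z, by simp [S, hz, hza], h⟩
    _ ≤ ∑ z ∈ S, _ := prob_exists_le _ _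
    _ ≤ #S • ((2 / 3 : ℝ) ^ p) := sum_le_card_nsmul _ _ _ fun z hz => by
        simp only [S, mem_filter, mem_univ, true_and] at hz
        exact prob_agreement_le hz.2 p
    _ ≤ _ := by
        rw [nsmul_eq_mul]
        gcongr
        exact_mod_cast hS

end Code

/-! ### Self-correction -/

section Noise

/-- The value of a parity at any point `u`, uniform or not, can be read off from a function `f`
close to it at two points, each of which is uniform. -/
theorem prob_selfCorrection_ne_le {n : ℕ} (f : BoolFun n) (a u : Cube n) :
    prob (fun r : Cube n => f (u + r) + f r ≠ parity a u) ≤ 2 * relDist f (parity a) := by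
  calc prob (fun r : Cube n => f (u + r) + f r ≠ parity a u)
      ≤ prob (fun r => f (u + r) ≠ parity a (u + r) ∨ f r ≠ parity a r) := by
        refine prob_mono fun r hr => ?_
        by_contra hne
        simp only [not_or, not_not] at hne
        apply hr
        rw [hne.1, hne.2, parity, parity, parity, dotProduct_add, add_assoc,
          CharTwo.add_self_eq_zero, add_zero]
    _ ≤ prob (fun r => f (u + r) ≠ parity a (u + r)) + prob (fun r => f r ≠ parity a r) :=
        prob_or_le _ _
    _ = 2 * relDist f (parity a) := by
        have h := prob_equiv (Equiv.addLeft u) fun r => f r ≠ parity a r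
        simp only [Equiv.coe_addLeft] at h
        rw [h, prob_ne_parity, two_mul]

/-- Markov's inequality for the number of errors of the self-corrected values. -/
theorem prob_many_errors_le {n p : ℕ} (hp : 0 < p) (f : BoolFun n) (a : Cube n)
    (u : Fin (4 * p) → Cube n) {δ : ℝ} (hδ : relDist f (parity a) ≤ δ) :
    prob (fun r : Fin (4 * p) → Cube n =>
      p ≤ 2 * #{i | f (u i + r i) + f (r i) ≠ parity a (u i)}) ≤ 16 * δ := by
  classical
  have hp' : (0 : ℝ) < p := by exact_mod_cast hp
  have hmk := prob_mul_le_expect (X := fun r : Fin (4 * p) → Cube n =>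
    (#{i | f (u i + r i) + f (r i) ≠ parity a (u i)} : ℝ)) (fun r => by positivity) (p / 2)
  have hexp : 𝔼 r : Fin (4 * p) → Cube n,
      (#{i | f (u i + r i) + f (r i) ≠ parity a (u i)} : ℝ) ≤ 4 * p * (2 * δ) := by
    simp_rw [← sum_boole]
    rw [expect_sum_comm]
    have hi : ∀ i : Fin (4 * p), 𝔼 r : Fin (4 * p) → Cube n,
        (if f (u i + r i) + f (r i) ≠ parity a (u i) then (1 : ℝ) else 0) ≤ 2 * δ := by
      intro i
      have h1 : prob (fun r : Fin (4 * p) → Cube n =>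
          f (u i + r i) + f (r i) ≠ parity a (u i)) ≤ 2 * δ := by
        refine prob_le_of_update i fun r => ?_
        simp only [update_self]
        exact (prob_selfCorrection_ne_le f a (u i)).trans (by linarith)
      unfold prob at h1
      convert h1
    calc _ ≤ ∑ _i : Fin (4 * p), 2 * δ := sum_le_sum fun i _ => hi i
      _ = 4 * p * (2 * δ) := by simp
  have heq : prob (fun r : Fin (4 * p) → Cube n =>
      p ≤ 2 * #{i | f (u i + r i) + f (r i) ≠ parity a (u i)}) ≤
      prob (fun r : Fin (4 * p) → Cube n =>
        (p / 2 : ℝ) ≤ (#{i | f (u i + r i) + f (r i) ≠ parity a (u i)} : ℝ)) := by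
    refine prob_mono fun r hr => ?_
    have : (p : ℝ) ≤ 2 * #{i | f (u i + r i) + f (r i) ≠ parity a (u i)} := by exact_mod_cast hr
    linarith
  refine heq.trans ?_
  refine le_of_mul_le_mul_right (hmk.trans (hexp.trans ?_)) (half_pos hp')
  linarith

end Noise

/-! ### The tester -/

/-- The names of the queries: three for each of the `b` runs of the linearity test, and two for each
of the `4p` self-corrected values. -/
abbrev QueryIndex (b p : ℕ) : Type := (Fin b × Fin 3) ⊕ (Fin (4 * p) × Fin 2)

/-- The random choices of the tester: `b` pairs of points for the linearity test, a hash function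
from the `n` coordinates to `m` buckets, `4p` points of the cube of buckets, and `4p` random shifts
for the self-correction. -/
abbrev Seed (n m b p : ℕ) : Type :=
  (Fin b → Cube n × Cube n) × (Fin n → Fin m) × (Fin (4 * p) → Cube m) × (Fin (4 * p) → Cube n)

section Tester

variable {n m b p : ℕ}

/-- The points queried for a given seed. -/
def seedQuery (ω : Seed n m b p) : QueryIndex b p → Cube n
  | .inl (i, j) => ![(ω.1 i).1, (ω.1 i).2, (ω.1 i).1 + (ω.1 i).2] j
  | .inr (i, j) => ![ω.2.2.1 i ∘ ω.2.1 + ω.2.2.2 i, ω.2.2.2 i] j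

/-- The acceptance condition: all runs of the linearity test pass, and some parity of weight `k` on
the buckets agrees with at least seven eighths of the self-corrected values. -/
def Accepts (k : ℕ) (ω : Seed n m b p) (ans : QueryIndex b p → ZMod 2) : Prop :=
  (∀ i, ans (.inl (i, 0)) + ans (.inl (i, 1)) = ans (.inl (i, 2))) ∧
    ∃ z : Cube m, hammingNorm z = k ∧
      7 * p ≤ 2 * #{i | ans (.inr (i, 0)) + ans (.inr (i, 1)) = parity z (ω.2.2.1 i)}

open Classical in
/-- The deterministic tester determined by a seed. -/
noncomputable def seedTester (k : ℕ) (ω : Seed n m b p) :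
    DetTester n (Fintype.card (QueryIndex b p)) where
  query := seedQuery ω ∘ (Fintype.equivFin _).symm
  decision ans := decide (Accepts k ω (ans ∘ Fintype.equivFin _))

theorem seedTester_run_eq_true_iff (k : ℕ) (ω : Seed n m b p) (f : BoolFun n) :
    (seedTester k ω).run f = true ↔
      (∀ i, f (ω.1 i).1 + f (ω.1 i).2 = f ((ω.1 i).1 + (ω.1 i).2)) ∧
        ∃ z : Cube m, hammingNorm z = k ∧ 7 * p ≤ 2 * #{i |
          f (ω.2.2.1 i ∘ ω.2.1 + ω.2.2.2 i) + f (ω.2.2.2 i) = parity z (ω.2.2.1 i)} := by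
  simp [seedTester, DetTester.run, Accepts, seedQuery]

theorem prob_reject_le_of_mem {k : ℕ} (hk : 1 ≤ k) (hm : m = 100 * k ^ 2) {f : BoolFun n}
    (hf : f ∈ PAR n k) :
    prob (fun ω : Seed n m b p => (seedTester k ω).run f ≠ true) ≤ 1 / 3 := by
  have : NeZero m := ⟨by subst hm; positivity⟩
  obtain ⟨a, ha, rfl⟩ := hf
  have hmain : ∀ ω : Seed n m b p, (seedTester k ω).run (parity a) ≠ true →
      hammingNorm (push ω.2.1 a) ≠ k := by
    intro ω hω hpush
    apply hω
    rw [seedTester_run_eq_true_iff]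
    refine ⟨fun i => (dotProduct_add _ _ _).symm, push ω.2.1 a, hpush, ?_⟩
    have hall : ∀ i, parity a (ω.2.2.1 i ∘ ω.2.1 + ω.2.2.2 i) + parity a (ω.2.2.2 i) =
        parity (push ω.2.1 a) (ω.2.2.1 i) := by
      intro i
      simp only [parity, dotProduct_push, dotProduct_add, add_assoc, CharTwo.add_self_eq_zero,
        add_zero]
    simp only [hall, filter_true, card_univ, Fintype.card_fin]
    omega
  refine (prob_mono hmain).trans ?_
  refine prob_prod_le_of_fst fun _ => prob_prod_le_of_snd fun _ => ?_
  exact (prob_hammingNorm_push_ne_le a hk hm ha).trans (by norm_num)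

/-- If `f` is close to a parity of weight different from `k`, then an accepting seed has one of
three defects: the hashed vector has weight `k`, a parity of weight `k` on the buckets is too close to the
hashed parity on the sample points, or self-correction fails too often. -/
theorem prob_accept_le_of_close {k : ℕ} (hk : 1 ≤ k) (hm : m = 100 * k ^ 2) (hp : 0 < p)
    (hmp : (m : ℝ) ^ k * (2 / 3) ^ p ≤ 1 / 20) {f : BoolFun n} {a : Cube n}
    (ha : hammingNorm a ≠ k) {δ : ℝ} (hδ : δ ≤ 1 / 320) (hf : relDist f (parity a) ≤ δ) :
    prob (fun ω : Seed n m b p => (seedTester k ω).run f ≠ false) ≤ 1 / 3 := by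
  classical
  have : NeZero m := ⟨by subst hm; positivity⟩
  let E₁ : Seed n m b p → Prop := fun ω => hammingNorm (push ω.2.1 a) = k
  let E₂ : Seed n m b p → Prop := fun ω => ∃ z : Cube m, hammingNorm z = k ∧ z ≠ push ω.2.1 a ∧
    3 * p ≤ #{i | parity z (ω.2.2.1 i) = parity (push ω.2.1 a) (ω.2.2.1 i)}
  let E₃ : Seed n m b p → Prop := fun ω => p ≤ 2 * #{i |
    f (ω.2.2.1 i ∘ ω.2.1 + ω.2.2.2 i) + f (ω.2.2.2 i) ≠ parity a (ω.2.2.1 i ∘ ω.2.1)}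
  have h1 : prob E₁ ≤ 1 / 10 := prob_prod_le_of_fst fun _ => prob_prod_le_of_snd fun _ =>
    prob_hammingNorm_push_eq_le a hk hm ha
  have h2 : prob E₂ ≤ 1 / 20 := prob_prod_le_of_fst fun _ => prob_prod_le_of_fst fun h =>
    prob_prod_le_of_snd fun _ => (prob_exists_agreement_le (push h a) k p).trans hmp
  have h3 : prob E₃ ≤ 1 / 20 := prob_prod_le_of_fst fun _ => prob_prod_le_of_fst fun h =>
    prob_prod_le_of_fst fun y =>
      (prob_many_errors_le hp f a (fun i => y i ∘ h) hf).trans (by linarith)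
  have hmain : ∀ ω : Seed n m b p, (seedTester k ω).run f ≠ false → E₁ ω ∨ E₂ ω ∨ E₃ ω := by
    intro ω hω
    rw [Bool.ne_false_iff, seedTester_run_eq_true_iff] at hω
    obtain ⟨-, z, hz, hagree⟩ := hω
    by_contra hne
    simp only [E₁, E₂, E₃, not_or, not_exists, not_and, not_le] at hne
    obtain ⟨hn1, hn2, hn3⟩ := hne
    have hn2 := hn2 z hz fun h => hn1 (h ▸ hz)
    -- A value that agrees with `z` agrees with the hashed parity there or is an error, so there are
    -- fewer than `3 * p + p / 2` agreements.
    have hsub : ({i | f (ω.2.2.1 i ∘ ω.2.1 + ω.2.2.2 i) + f (ω.2.2.2 i) =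
          parity z (ω.2.2.1 i)} : Finset (Fin (4 * p))) ⊆
        ({i | parity z (ω.2.2.1 i) = parity (push ω.2.1 a) (ω.2.2.1 i)} : Finset (Fin (4 * p))) ∪
        ({i | f (ω.2.2.1 i ∘ ω.2.1 + ω.2.2.2 i) + f (ω.2.2.2 i) ≠
          parity a (ω.2.2.1 i ∘ ω.2.1)} : Finset (Fin (4 * p))) := by
      intro i hi
      simp only [mem_union, mem_filter, mem_univ, true_and] at hi ⊢
      rw [hi]
      simp only [parity, dotProduct_push]
      exact em _
    have := (card_le_card hsub).trans (card_union_le _ _)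
    omega
  have := prob_or_le E₁ fun ω => E₂ ω ∨ E₃ ω
  have := prob_or_le E₂ E₃
  have := prob_mono hmain
  linarith

theorem prob_accept_le_of_isFar {k : ℕ} (hk : 1 ≤ k) (hm : m = 100 * k ^ 2) (hp : 0 < p)
    (hmp : (m : ℝ) ^ k * (2 / 3) ^ p ≤ 1 / 20) {ε δ : ℝ} (hδε : δ < ε) (hδ : δ ≤ 1 / 320)
    (hb : (1 - δ) ^ b ≤ 1 / 3) {f : BoolFun n} (hf : IsFar ε f (PAR n k)) :
    prob (fun ω : Seed n m b p => (seedTester k ω).run f ≠ false) ≤ 1 / 3 := by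
  have : NeZero m := ⟨by subst hm; positivity⟩
  by_cases hlin : prob (fun p : Cube n × Cube n => f p.1 + f p.2 ≠ f (p.1 + p.2)) ≤ δ
  · obtain ⟨a, ha⟩ := exists_parity_close_of_linearity_test f hlin
    have hak : hammingNorm a ≠ k := fun h =>
      (hδε.trans_le (hf _ ⟨a, h, rfl⟩)).not_ge ha
    exact prob_accept_le_of_close hk hm hp hmp hak hδ ha
  · have hpass : prob (fun p : Cube n × Cube n => f p.1 + f p.2 = f (p.1 + p.2)) ≤ 1 - δ := by
      have := prob_not fun p : Cube n × Cube n => f p.1 + f p.2 = f (p.1 + p.2)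
      linarith
    refine le_trans (prob_mono (Q := fun ω : Seed n m b p =>
      ∀ i, f (ω.1 i).1 + f (ω.1 i).2 = f ((ω.1 i).1 + (ω.1 i).2)) fun ω hω => ?_) ?_
    · rw [Bool.ne_false_iff, seedTester_run_eq_true_iff] at hω
      exact hω.1
    · refine prob_prod_le_of_snd fun _ => ?_
      rw [prob_forall_apply b fun p : Cube n × Cube n => f p.1 + f p.2 = f (p.1 + p.2)]
      exact (pow_le_pow_left₀ (prob_nonneg _) hpass _).trans hb

end Tester

/-! ### The number of queries -/

/-- `O(k log k)` sample points suffice for the union bound over the parities of weight `k` on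
`100 k ^ 2` buckets. -/
theorem pow_mul_two_thirds_pow_le {k p : ℕ} (hk : 1 ≤ k)
    (hp : 48 * max 1 ((k : ℝ) * Real.log k) ≤ p) :
    ((100 * k ^ 2 : ℕ) : ℝ) ^ k * (2 / 3) ^ p ≤ 1 / 20 := by
  set M := max 1 ((k : ℝ) * Real.log k)
  have hM1 : 1 ≤ M := le_max_left _ _
  have hMk : k * Real.log k ≤ M := le_max_right _ _
  have hk0 : (0 : ℝ) < k := by exact_mod_cast hk
  have hkM : (k : ℝ) ≤ 2 * M := by
    rcases hk.eq_or_lt with rfl | hk2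
    · push_cast
      linarith
    · have h2 : Real.log 2 ≤ Real.log k :=
        Real.log_le_log (by norm_num) (by exact_mod_cast hk2)
      have := Real.log_two_gt_d9
      nlinarith
  have he := Real.exp_one_gt_d9
  have h100 : Real.log 100 ≤ 5 := by
    rw [Real.log_le_iff_le_exp (by norm_num), show (5 : ℝ) = (5 : ℕ) * 1 by norm_num,
      Real.exp_nat_mul]
    exact le_trans (by norm_num) (pow_le_pow_left₀ (by norm_num : (0 : ℝ) ≤ 2.7) (by linarith) 5)
  have h20 : Real.log 20 ≤ 4 := by
    rw [Real.log_le_iff_le_exp (by norm_num), show (4 : ℝ) = (4 : ℕ) * 1 by norm_num,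
      Real.exp_nat_mul]
    exact le_trans (by norm_num) (pow_le_pow_left₀ (by norm_num : (0 : ℝ) ≤ 2.7) (by linarith) 4)
  have h23 : Real.log (2 / 3) ≤ -(1 / 3) :=
    (Real.log_le_sub_one_of_pos (by norm_num)).trans (by norm_num)
  have hpos : (0 : ℝ) < ((100 * k ^ 2 : ℕ) : ℝ) := by
    push_cast
    positivity
  rw [← Real.log_le_log_iff (by positivity) (by norm_num), Real.log_mul (by positivity)
    (by positivity), Real.log_pow, Real.log_pow, one_div, Real.log_inv]
  push_cast
  rw [Real.log_mul (by norm_num) (by positivity), Real.log_pow]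
  push_cast
  have hp' : (p : ℝ) * Real.log (2 / 3) ≤ p * -(1 / 3) :=
    mul_le_mul_of_nonneg_left h23 (Nat.cast_nonneg _)
  have hk100 : (k : ℝ) * Real.log 100 ≤ k * 5 := mul_le_mul_of_nonneg_left h100 hk0.le
  linarith

end ParityTesting

/-- For `k ≥ 2` the bound `max 1 (k * log k)` is just `k * log k`; for `k = 1`, where `k * log k`
vanishes, it is `1`. -/
theorem mainTheorem1 (ε : ℝ) (hε : 0 < ε) :
    ∃ C : ℝ, 0 < C ∧ ∀ n k : ℕ, 1 ≤ k → k ≤ n →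
      ∃ q : ℕ, (q : ℝ) ≤ C * max 1 ((k : ℝ) * Real.log (k : ℝ)) ∧
        ∃ T : ParityTesting.Tester n q,
          ParityTesting.Tester.Tests T ε (ParityTesting.PAR n k) := by
  -- `δ < ε` excludes that a far function is `δ`-close to a parity of weight `k`, and
  -- `16 δ ≤ 1 / 20` bounds the probability of too many self-correction errors.
  let δ : ℝ := min (ε / 2) (1 / 320)
  have hδ0 : 0 < δ := lt_min (half_pos hε) (by norm_num)
  have hδε : δ < ε := (min_le_left _ _).trans_lt (half_lt_self hε)
  obtain ⟨b, hb⟩ := exists_pow_lt_of_lt_one (show (0 : ℝ) < 1 / 3 by norm_num)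
    (show 1 - δ < 1 by linarith)
  refine ⟨3 * b + 392, by positivity, fun n k hk _ => ?_⟩
  set M := max 1 ((k : ℝ) * Real.log k)
  have hM : 1 ≤ M := le_max_left _ _
  let p := ⌈48 * M⌉₊
  have hpM : 48 * M ≤ p := Nat.le_ceil _
  have hp : 0 < p := Nat.ceil_pos.mpr (by linarith)
  have hpM' : (p : ℝ) < 48 * M + 1 := Nat.ceil_lt_add_one (by linarith)
  have : NeZero (100 * k ^ 2) := ⟨by positivity⟩
  refine ⟨Fintype.card (ParityTesting.QueryIndex b p), ?_,
    PMF.map (ParityTesting.seedTester k)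
      (PMF.uniformOfFintype (ParityTesting.Seed n (100 * k ^ 2) b p)), fun f hf => ?_,
    fun f hf => ?_⟩
  · simp only [Fintype.card_sum, Fintype.card_prod, Fintype.card_fin]
    push_cast
    nlinarith [mul_le_mul_of_nonneg_left hM (Nat.cast_nonneg (α := ℝ) b)]
  · rw [ParityTesting.Tester.output, PMF.map_comp]
    exact ParityTesting.two_thirds_le_map_uniform
      (ParityTesting.prob_reject_le_of_mem hk rfl hf)
  · rw [ParityTesting.Tester.output, PMF.map_comp]
    exact ParityTesting.two_thirds_le_map_uniform
      (ParityTesting.prob_accept_le_of_isFar hk rfl hp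
        (ParityTesting.pow_mul_two_thirds_pow_le hk hpM) hδε (min_le_right _ _) hb.le hf)
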